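/- **Theorem.** A *restriction monoid* is a monoid $S$ with two unary operations $^*$ and $^+$ such that, for all $x,y\in S$, $$xx^*=x,\quad x^*y^*=y^*x^*,\quad (xy^*)^*=x^*y^*,\quad x^*y=y(xy)^*,$$ $$x^+x=x,\quad x^+y^+=y^+x^+,\quad (x^+y)^+=x^+y^+,\quad xy^+=(xy)^+x,$$ $$(x^+)^*=x^+,\quad (x^*)^+=x^*;$$ homomorphisms and restriction submonoids respect $\cdot,{}^*,{}^+,1$. An *inverse monoid* is a monoid with an involution $x\mapsto x^{-1}$ (that is, $(x^{-1})^{-1}=x$ and $(xy)^{-1}=y^{-1}x^{-1}$) satisfying $xx^{-1}x=x$ and $xx^{-1}yy^{-1}=yy^{-1}xx^{-1}$; it is a restriction monoid under $x^*=x^{-1}x$, $x^+=xx^{-1}$. For a set $X$ let $\mathcal{FR}(X)$ and $\mathcal{FI}(X)$ be the free restriction monoid and the free inverse monoid on $X$. For an inverse monoid $S$ let $E(S)$ be its set of idempotents. Let $M$ be a monoid, and let $M'=\{\lfloor m\rfloor : m\in M\}$ and $M''=\{[m]:m\in M\}$ be bijective copies of its underlying set. Let $R$ be a set of relations on $\mathcal{FR}(M')$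 that is *admissible*: the relations $$\lfloor 1\rfloor=1,\qquad \lfloor m\rfloor\lfloor n\rfloor=(\lfloor m\rfloor\lfloor n\rfloor)^+\lfloor mn\rfloor\quad (m,n\in M)$$ belong to $R$ or follow from $R$, and all relations in $R$ follow from the relations $$\lfloor 1\rfloor=1,\qquad \lfloor m\rfloor\lfloor n\rfloor=\lfloor mn\rfloor\quad (m,n\in M). \tag{H}$$ Let $\mathcal{FR}_R(M)$ be the restriction monoid generated by $M'$ subject to $R$. Let $\mathcal{FI}_R(M)$ be the inverse monoid generated by $M''$ subject to the image of $R$ under the homomorphism of restriction monoids $\mathcal{FR}(M')\to\mathcal{FI}(M'')$, $\lfloor m\rfloor\mapsto[m]$. 1. Suppose that $M$ embeds into a group. Then the set $$T=\{e[m] : e\in E(\mathcal{FI}_R(M)),\ m\in M\}$$ is a restriction submonoid of $\mathcal{FI}_R(M)$, and there is an isomorphism of restriction monoids $\mathcal{FR}_R(M)\to T$ with $\lfloor m\rfloor\mapsto[m]$ for all $m\in M$. Moreover, $T$ is the restriction submonoid of $\mathcal{FI}_R(M)$ generated by $\{[m]:m\in M\}$ under $\cdot,{}^*,{}^+,1$,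 and it is also the submonoid of $\mathcal{FI}_R(M)$ generated by $E(\mathcal{FI}_R(M))\cup\{[m]:m\in M\}$ under $\cdot,1$. 2. In particular (the Fountain–Gomes–Gould description of $\mathcal{FR}(A)$), let $A$ be a set, let $M=A^*$ be the free monoid on $A$, and let $R$ consist of the relations (H). Then $R$ is admissible, and there are isomorphisms $\mathcal{FR}_R(A^*)\to\mathcal{FR}(A)$ with $\lfloor a\rfloor\mapsto a$ and $\mathcal{FI}_R(A^*)\to\mathcal{FI}(A)$ with $[a]\mapsto a$ $(a\in A)$, of restriction monoids and of inverse monoids respectively. The set $\{ev : e\in E(\mathcal{FI}(A)),\ v\in A^*\}$, where $v$ stands for its value in $\mathcal{FI}(A)$, is a restriction submonoid of $\mathcal{FI}(A)$. It is generated by $A$ under $\cdot,{}^*,{}^+,1$ and by $E(\mathcal{FI}(A))\cup A$ under $\cdot,1$, and there is an isomorphism of restriction monoids from $\mathcal{FR}(A)$ onto it that fixes every $a\in A$. -/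

import Mathlib

universe u v w

/-! ## Restriction monoids -/

/-- A (two-sided) restriction monoid, an algebra of type `(2,1,1,0)`:
`rstar x` is `x^*` and `rplus x` is `x^+`. -/
class RestrictionMonoid (S : Type u) extends Monoid S where
  rstar : S → S
  rplus : S → S
  mul_rstar_self : ∀ x : S, x * rstar x = x
  rstar_comm : ∀ x y : S, rstar x * rstar y = rstar y * rstar x
  rstar_mul_rstar : ∀ x y : S, rstar (x * rstar y) = rstar x * rstar y
  rstar_mul : ∀ x y : S, rstar x * y = y * rstar (x * y)
  rplus_mul_self : ∀ x : S, rplus x * x = x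
  rplus_comm : ∀ x y : S, rplus x * rplus y = rplus y * rplus x
  rplus_rplus_mul : ∀ x y : S, rplus (rplus x * y) = rplus x * rplus y
  mul_rplus : ∀ x y : S, x * rplus y = rplus (x * y) * x
  rstar_rplus : ∀ x : S, rstar (rplus x) = rplus x
  rplus_rstar : ∀ x : S, rplus (rstar x) = rstar x

open RestrictionMonoid (rstar rplus)

/-- Homomorphisms of restriction monoids: `(2,1,1,0)`-homomorphisms. -/
structure RestrictionMonoidHom (S : Type u) (T : Type v)
    [RestrictionMonoid S] [RestrictionMonoid T] extends S →* T where
  map_rstar' : ∀ x : S, toFun (rstar x) = rstar (toFun x)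
  map_rplus' : ∀ x : S, toFun (rplus x) = rplus (toFun x)

instance RestrictionMonoidHom.instFunLike (S : Type u) (T : Type v)
    [RestrictionMonoid S] [RestrictionMonoid T] : FunLike (RestrictionMonoidHom S T) S T where
  coe f := f.toFun
  coe_injective f g h := by
    obtain ⟨f, _, _⟩ := f
    obtain ⟨g, _, _⟩ := g
    have : f = g := DFunLike.coe_injective h
    subst this
    rfl

/-- A restriction submonoid: a `(2,1,1,0)`-subalgebra. -/
structure RestrictionSubmonoid (S : Type u) [RestrictionMonoid S] extends Submonoid S where
  rstar_mem' : ∀ {x : S}, x ∈ carrier → rstar x ∈ carrier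
  rplus_mem' : ∀ {x : S}, x ∈ carrier → rplus x ∈ carrier

namespace RestrictionSubmonoid

variable {S : Type u} [RestrictionMonoid S]

instance instSetLike : SetLike (RestrictionSubmonoid S) S where
  coe T := T.carrier
  coe_injective T U h := by
    obtain ⟨T, _, _⟩ := T
    obtain ⟨U, _, _⟩ := U
    have : T = U := SetLike.coe_injective h
    subst this
    rfl

/-- A restriction submonoid is a restriction monoid under the restricted operations. -/
instance instRestrictionMonoid (T : RestrictionSubmonoid S) : RestrictionMonoid T where
  mul x y := ⟨x.1 * y.1, T.mul_mem' x.2 y.2⟩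
  one := ⟨1, T.one_mem'⟩
  rstar x := ⟨rstar x.1, T.rstar_mem' x.2⟩
  rplus x := ⟨rplus x.1, T.rplus_mem' x.2⟩
  mul_assoc _ _ _ := Subtype.ext (mul_assoc _ _ _)
  one_mul _ := Subtype.ext (one_mul _)
  mul_one _ := Subtype.ext (mul_one _)
  mul_rstar_self _ := Subtype.ext (RestrictionMonoid.mul_rstar_self _)
  rstar_comm _ _ := Subtype.ext (RestrictionMonoid.rstar_comm _ _)
  rstar_mul_rstar _ _ := Subtype.ext (RestrictionMonoid.rstar_mul_rstar _ _)
  rstar_mul _ _ := Subtype.ext (RestrictionMonoid.rstar_mul _ _)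
  rplus_mul_self _ := Subtype.ext (RestrictionMonoid.rplus_mul_self _)
  rplus_comm _ _ := Subtype.ext (RestrictionMonoid.rplus_comm _ _)
  rplus_rplus_mul _ _ := Subtype.ext (RestrictionMonoid.rplus_rplus_mul _ _)
  mul_rplus _ _ := Subtype.ext (RestrictionMonoid.mul_rplus _ _)
  rstar_rplus _ := Subtype.ext (RestrictionMonoid.rstar_rplus _)
  rplus_rstar _ := Subtype.ext (RestrictionMonoid.rplus_rstar _)

/-- The restriction submonoid generated by a set under `·`, `^*`, `^+`, `1`:
the intersection of all restriction submonoids that contain the set. -/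
def closure (X : Set S) : RestrictionSubmonoid S where
  carrier := {x | ∀ T : RestrictionSubmonoid S, X ⊆ (T : Set S) → x ∈ T}
  mul_mem' hx hy T hT := T.mul_mem' (hx T hT) (hy T hT)
  one_mem' T _ := T.one_mem'
  rstar_mem' hx T hT := T.rstar_mem' (hx T hT)
  rplus_mem' hx T hT := T.rplus_mem' (hx T hT)

end RestrictionSubmonoid

/-- The `(2,1,1,0)`-congruence on a restriction monoid generated by the relation `r`. -/
inductive RestrictionMonoid.CongGen {S : Type u} [RestrictionMonoid S] (r : S → S → Prop) :
    S → S → Prop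
  | of {x y : S} : r x y → CongGen r x y
  | refl (x : S) : CongGen r x x
  | symm {x y : S} : CongGen r x y → CongGen r y x
  | trans {x y z : S} : CongGen r x y → CongGen r y z → CongGen r x z
  | mul {x x' y y' : S} : CongGen r x x' → CongGen r y y' → CongGen r (x * y) (x' * y')
  | rstar {x y : S} : CongGen r x y → CongGen r (rstar x) (rstar y)
  | rplus {x y : S} : CongGen r x y → CongGen r (rplus x) (rplus y)

/-- The quotient of the restriction monoid `S` subject to the relations `r`. -/
def RestrictionMonoid.Presented {S : Type u} [RestrictionMonoid S] (r : S → S → Prop) : Type u :=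
  Quot (RestrictionMonoid.CongGen r)

namespace RestrictionMonoid.Presented

variable {S : Type u} [RestrictionMonoid S] (r : S → S → Prop)

instance instRestrictionMonoid : RestrictionMonoid (RestrictionMonoid.Presented r) where
  mul := Quot.map₂ (· * ·) (fun _ _ _ h => .mul (.refl _) h) (fun _ _ _ h => .mul h (.refl _))
  one := Quot.mk _ 1
  rstar := Quot.map RestrictionMonoid.rstar fun _ _ h => .rstar h
  rplus := Quot.map RestrictionMonoid.rplus fun _ _ h => .rplus h
  mul_assoc := by
    rintro ⟨x⟩ ⟨y⟩ ⟨z⟩; exact congrArg (Quot.mk _) (mul_assoc x y z)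
  one_mul := by rintro ⟨x⟩; exact congrArg (Quot.mk _) (one_mul x)
  mul_one := by rintro ⟨x⟩; exact congrArg (Quot.mk _) (mul_one x)
  mul_rstar_self := by rintro ⟨x⟩; exact congrArg (Quot.mk _) (mul_rstar_self x)
  rstar_comm := by rintro ⟨x⟩ ⟨y⟩; exact congrArg (Quot.mk _) (rstar_comm x y)
  rstar_mul_rstar := by rintro ⟨x⟩ ⟨y⟩; exact congrArg (Quot.mk _) (rstar_mul_rstar x y)
  rstar_mul := by rintro ⟨x⟩ ⟨y⟩; exact congrArg (Quot.mk _) (rstar_mul x y)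
  rplus_mul_self := by rintro ⟨x⟩; exact congrArg (Quot.mk _) (rplus_mul_self x)
  rplus_comm := by rintro ⟨x⟩ ⟨y⟩; exact congrArg (Quot.mk _) (rplus_comm x y)
  rplus_rplus_mul := by rintro ⟨x⟩ ⟨y⟩; exact congrArg (Quot.mk _) (rplus_rplus_mul x y)
  mul_rplus := by rintro ⟨x⟩ ⟨y⟩; exact congrArg (Quot.mk _) (mul_rplus x y)
  rstar_rplus := by rintro ⟨x⟩; exact congrArg (Quot.mk _) (rstar_rplus x)
  rplus_rstar := by rintro ⟨x⟩; exact congrArg (Quot.mk _) (rplus_rstar x)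

/-- The class of an element in the quotient. -/
def mk (x : S) : RestrictionMonoid.Presented r := Quot.mk _ x

end RestrictionMonoid.Presented

/-! ## The free restriction monoid on a set -/

/-- Terms of type `(2,1,1,0)` over the set `X` of variables. -/
inductive RestrictionTerm (X : Type u) : Type u
  | var : X → RestrictionTerm X
  | one : RestrictionTerm X
  | mul : RestrictionTerm X → RestrictionTerm X → RestrictionTerm X
  | star : RestrictionTerm X → RestrictionTerm X
  | plus : RestrictionTerm X → RestrictionTerm X

/-- Provable equality of terms from the identities of restriction monoids. -/
inductive RestrictionTerm.Eqv {X : Type u} : RestrictionTerm X → RestrictionTerm X → Prop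
  | refl (x) : Eqv x x
  | symm {x y} : Eqv x y → Eqv y x
  | trans {x y z} : Eqv x y → Eqv y z → Eqv x z
  | mul {x x' y y'} : Eqv x x' → Eqv y y' → Eqv (.mul x y) (.mul x' y')
  | star {x y} : Eqv x y → Eqv (.star x) (.star y)
  | plus {x y} : Eqv x y → Eqv (.plus x) (.plus y)
  | mul_assoc (x y z) : Eqv (.mul (.mul x y) z) (.mul x (.mul y z))
  | one_mul (x) : Eqv (.mul .one x) x
  | mul_one (x) : Eqv (.mul x .one) x
  | mul_star_self (x) : Eqv (.mul x (.star x)) x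
  | star_comm (x y) : Eqv (.mul (.star x) (.star y)) (.mul (.star y) (.star x))
  | star_mul_star (x y) : Eqv (.star (.mul x (.star y))) (.mul (.star x) (.star y))
  | star_mul (x y) : Eqv (.mul (.star x) y) (.mul y (.star (.mul x y)))
  | plus_mul_self (x) : Eqv (.mul (.plus x) x) x
  | plus_comm (x y) : Eqv (.mul (.plus x) (.plus y)) (.mul (.plus y) (.plus x))
  | plus_plus_mul (x y) : Eqv (.plus (.mul (.plus x) y)) (.mul (.plus x) (.plus y))
  | mul_plus (x y) : Eqv (.mul x (.plus y)) (.mul (.plus (.mul x y)) x)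
  | star_plus (x) : Eqv (.star (.plus x)) (.plus x)
  | plus_star (x) : Eqv (.plus (.star x)) (.star x)

/-- The value of a term in a restriction monoid. -/
def RestrictionTerm.eval {X : Type u} {S : Type v} [RestrictionMonoid S] (f : X → S) :
    RestrictionTerm X → S
  | .var x => f x
  | .one => 1
  | .mul s t => s.eval f * t.eval f
  | .star t => rstar (t.eval f)
  | .plus t => rplus (t.eval f)

theorem RestrictionTerm.Eqv.eval_eq {X : Type u} {S : Type v} [RestrictionMonoid S] (f : X → S)
    {s t : RestrictionTerm X} (h : s.Eqv t) : s.eval f = t.eval f := by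
  induction h with
  | refl => rfl
  | symm _ ih => exact ih.symm
  | trans _ _ ih₁ ih₂ => exact ih₁.trans ih₂
  | mul _ _ ih₁ ih₂ => simp only [RestrictionTerm.eval, ih₁, ih₂]
  | star _ ih => simp only [RestrictionTerm.eval, ih]
  | plus _ ih => simp only [RestrictionTerm.eval, ih]
  | mul_assoc => exact _root_.mul_assoc _ _ _
  | one_mul => exact _root_.one_mul _
  | mul_one => exact _root_.mul_one _
  | mul_star_self => exact RestrictionMonoid.mul_rstar_self _
  | star_comm => exact RestrictionMonoid.rstar_comm _ _
  | star_mul_star => exact RestrictionMonoid.rstar_mul_rstar _ _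
  | star_mul => exact RestrictionMonoid.rstar_mul _ _
  | plus_mul_self => exact RestrictionMonoid.rplus_mul_self _
  | plus_comm => exact RestrictionMonoid.rplus_comm _ _
  | plus_plus_mul => exact RestrictionMonoid.rplus_rplus_mul _ _
  | mul_plus => exact RestrictionMonoid.mul_rplus _ _
  | star_plus => exact RestrictionMonoid.rstar_rplus _
  | plus_star => exact RestrictionMonoid.rplus_rstar _

/-- The free restriction monoid `FR(X)` on the set `X`. -/
def FreeRestrictionMonoid (X : Type u) : Type u := Quot (RestrictionTerm.Eqv (X := X))

namespace FreeRestrictionMonoid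

variable {X : Type u}

instance instRestrictionMonoid : RestrictionMonoid (FreeRestrictionMonoid X) where
  mul := Quot.map₂ .mul (fun _ _ _ h => .mul (.refl _) h) (fun _ _ _ h => .mul h (.refl _))
  one := Quot.mk _ .one
  rstar := Quot.map .star fun _ _ h => .star h
  rplus := Quot.map .plus fun _ _ h => .plus h
  mul_assoc := by rintro ⟨x⟩ ⟨y⟩ ⟨z⟩; exact Quot.sound (.mul_assoc x y z)
  one_mul := by rintro ⟨x⟩; exact Quot.sound (.one_mul x)
  mul_one := by rintro ⟨x⟩; exact Quot.sound (.mul_one x)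
  mul_rstar_self := by rintro ⟨x⟩; exact Quot.sound (.mul_star_self x)
  rstar_comm := by rintro ⟨x⟩ ⟨y⟩; exact Quot.sound (.star_comm x y)
  rstar_mul_rstar := by rintro ⟨x⟩ ⟨y⟩; exact Quot.sound (.star_mul_star x y)
  rstar_mul := by rintro ⟨x⟩ ⟨y⟩; exact Quot.sound (.star_mul x y)
  rplus_mul_self := by rintro ⟨x⟩; exact Quot.sound (.plus_mul_self x)
  rplus_comm := by rintro ⟨x⟩ ⟨y⟩; exact Quot.sound (.plus_comm x y)
  rplus_rplus_mul := by rintro ⟨x⟩ ⟨y⟩; exact Quot.sound (.plus_plus_mul x y)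
  mul_rplus := by rintro ⟨x⟩ ⟨y⟩; exact Quot.sound (.mul_plus x y)
  rstar_rplus := by rintro ⟨x⟩; exact Quot.sound (.star_plus x)
  rplus_rstar := by rintro ⟨x⟩; exact Quot.sound (.plus_star x)

/-- The free generators. -/
def of (x : X) : FreeRestrictionMonoid X := Quot.mk _ (.var x)

/-- The homomorphism of restriction monoids that extends a map of the generators. -/
def lift {S : Type v} [RestrictionMonoid S] (f : X → S) :
    RestrictionMonoidHom (FreeRestrictionMonoid X) S where
  toFun := Quot.lift (RestrictionTerm.eval f) fun _ _ h => h.eval_eq f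
  map_one' := rfl
  map_mul' := by rintro ⟨x⟩ ⟨y⟩; rfl
  map_rstar' := by rintro ⟨x⟩; rfl
  map_rplus' := by rintro ⟨x⟩; rfl

end FreeRestrictionMonoid

/-! ## Inverse monoids -/

/-- An inverse monoid, an algebra of type `(2,1,0)`. -/
class InverseMonoid (S : Type u) extends Monoid S, Inv S where
  inv_inv' : ∀ x : S, x⁻¹⁻¹ = x
  mul_inv_rev' : ∀ x y : S, (x * y)⁻¹ = y⁻¹ * x⁻¹
  mul_inv_mul_self : ∀ x : S, x * x⁻¹ * x = x
  mul_inv_comm : ∀ x y : S, x * x⁻¹ * (y * y⁻¹) = y * y⁻¹ * (x * x⁻¹)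

namespace InverseMonoid

variable {S : Type u} [InverseMonoid S]

theorem inv_mul_comm' (x y : S) : x⁻¹ * x * (y⁻¹ * y) = y⁻¹ * y * (x⁻¹ * x) := by
  simpa [inv_inv'] using mul_inv_comm x⁻¹ y⁻¹

theorem inv_mul_comm_mul_inv (x y : S) : x⁻¹ * x * (y * y⁻¹) = y * y⁻¹ * (x⁻¹ * x) := by
  simpa [inv_inv'] using mul_inv_comm x⁻¹ y

theorem inv_mul_mul_inv (x : S) : x⁻¹ * x * x⁻¹ = x⁻¹ := by
  simpa [inv_inv'] using mul_inv_mul_self x⁻¹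

/-- An inverse monoid as a restriction monoid: `x^* = x⁻¹x` and `x^+ = xx⁻¹`. -/
instance toRestrictionMonoid : RestrictionMonoid S where
  rstar x := x⁻¹ * x
  rplus x := x * x⁻¹
  mul_rstar_self x := by rw [← mul_assoc, mul_inv_mul_self]
  rstar_comm := inv_mul_comm'
  rstar_mul_rstar x y := by
    calc (x * (y⁻¹ * y))⁻¹ * (x * (y⁻¹ * y))
        = y⁻¹ * y * (x⁻¹ * x) * (y⁻¹ * y) := by simp only [mul_inv_rev', inv_inv', mul_assoc]
      _ = x⁻¹ * x * (y⁻¹ * y * y⁻¹ * y) := by rw [← inv_mul_comm']; simp only [mul_assoc]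
      _ = x⁻¹ * x * (y⁻¹ * y) := by rw [inv_mul_mul_inv]
  rstar_mul x y := by
    calc x⁻¹ * x * y = x⁻¹ * x * (y * y⁻¹ * y) := by rw [mul_inv_mul_self]
      _ = x⁻¹ * x * (y * y⁻¹) * y := by simp only [mul_assoc]
      _ = y * ((x * y)⁻¹ * (x * y)) := by
        rw [inv_mul_comm_mul_inv]; simp only [mul_inv_rev', mul_assoc]
  rplus_mul_self := mul_inv_mul_self
  rplus_comm := mul_inv_comm
  rplus_rplus_mul x y := by
    calc x * x⁻¹ * y * (x * x⁻¹ * y)⁻¹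
        = x * x⁻¹ * (y * y⁻¹) * (x * x⁻¹) := by simp only [mul_inv_rev', inv_inv', mul_assoc]
      _ = x * x⁻¹ * x * x⁻¹ * (y * y⁻¹) := by
        rw [mul_assoc, ← mul_inv_comm x y]; simp only [mul_assoc]
      _ = x * x⁻¹ * (y * y⁻¹) := by rw [mul_inv_mul_self]
  mul_rplus x y := by
    calc x * (y * y⁻¹) = x * x⁻¹ * x * (y * y⁻¹) := by rw [mul_inv_mul_self]
      _ = x * (x⁻¹ * x * (y * y⁻¹)) := by simp only [mul_assoc]
      _ = x * y * (x * y)⁻¹ * x := by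
        rw [inv_mul_comm_mul_inv]; simp only [mul_inv_rev', mul_assoc]
  rstar_rplus x := by
    calc (x * x⁻¹)⁻¹ * (x * x⁻¹) = x * x⁻¹ * x * x⁻¹ := by
          simp only [mul_inv_rev', inv_inv', mul_assoc]
      _ = x * x⁻¹ := by rw [mul_inv_mul_self]
  rplus_rstar x := by
    calc x⁻¹ * x * (x⁻¹ * x)⁻¹ = x⁻¹ * x * x⁻¹ * x := by
          simp only [mul_inv_rev', inv_inv', mul_assoc]
      _ = x⁻¹ * x := by rw [inv_mul_mul_inv]

/-- The `(2,1,0)`-congruence on an inverse monoid generated by the relation `r`. -/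
inductive CongGen (r : S → S → Prop) : S → S → Prop
  | of {x y : S} : r x y → CongGen r x y
  | refl (x : S) : CongGen r x x
  | symm {x y : S} : CongGen r x y → CongGen r y x
  | trans {x y z : S} : CongGen r x y → CongGen r y z → CongGen r x z
  | mul {x x' y y' : S} : CongGen r x x' → CongGen r y y' → CongGen r (x * y) (x' * y')
  | inv {x y : S} : CongGen r x y → CongGen r x⁻¹ y⁻¹

/-- The quotient of the inverse monoid `S` subject to the relations `r`. -/
def Presented (r : S → S → Prop) : Type u := Quot (CongGen r)

namespace Presented

variable (r : S → S → Prop)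

instance instInverseMonoid : InverseMonoid (InverseMonoid.Presented r) where
  mul := Quot.map₂ (· * ·) (fun _ _ _ h => .mul (.refl _) h) (fun _ _ _ h => .mul h (.refl _))
  one := Quot.mk _ 1
  inv := Quot.map (·⁻¹) fun _ _ h => .inv h
  mul_assoc := by rintro ⟨x⟩ ⟨y⟩ ⟨z⟩; exact congrArg (Quot.mk _) (mul_assoc x y z)
  one_mul := by rintro ⟨x⟩; exact congrArg (Quot.mk _) (one_mul x)
  mul_one := by rintro ⟨x⟩; exact congrArg (Quot.mk _) (mul_one x)
  inv_inv' := by rintro ⟨x⟩; exact congrArg (Quot.mk _) (inv_inv' x)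
  mul_inv_rev' := by rintro ⟨x⟩ ⟨y⟩; exact congrArg (Quot.mk _) (mul_inv_rev' x y)
  mul_inv_mul_self := by rintro ⟨x⟩; exact congrArg (Quot.mk _) (mul_inv_mul_self x)
  mul_inv_comm := by rintro ⟨x⟩ ⟨y⟩; exact congrArg (Quot.mk _) (mul_inv_comm x y)

/-- The class of an element in the quotient. -/
def mk (x : S) : InverseMonoid.Presented r := Quot.mk _ x

end Presented

end InverseMonoid

/-! ## The free inverse monoid on a set -/

/-- Terms of type `(2,1,0)` over the set `X` of variables. -/
inductive InverseTerm (X : Type u) : Type u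
  | var : X → InverseTerm X
  | one : InverseTerm X
  | mul : InverseTerm X → InverseTerm X → InverseTerm X
  | inv : InverseTerm X → InverseTerm X

/-- Provable equality of terms from the identities of inverse monoids. -/
inductive InverseTerm.Eqv {X : Type u} : InverseTerm X → InverseTerm X → Prop
  | refl (x) : Eqv x x
  | symm {x y} : Eqv x y → Eqv y x
  | trans {x y z} : Eqv x y → Eqv y z → Eqv x z
  | mul {x x' y y'} : Eqv x x' → Eqv y y' → Eqv (.mul x y) (.mul x' y')
  | inv {x y} : Eqv x y → Eqv (.inv x) (.inv y)
  | mul_assoc (x y z) : Eqv (.mul (.mul x y) z) (.mul x (.mul y z))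
  | one_mul (x) : Eqv (.mul .one x) x
  | mul_one (x) : Eqv (.mul x .one) x
  | inv_inv (x) : Eqv (.inv (.inv x)) x
  | mul_inv_rev (x y) : Eqv (.inv (.mul x y)) (.mul (.inv y) (.inv x))
  | mul_inv_mul_self (x) : Eqv (.mul (.mul x (.inv x)) x) x
  | mul_inv_comm (x y) : Eqv (.mul (.mul x (.inv x)) (.mul y (.inv y)))
      (.mul (.mul y (.inv y)) (.mul x (.inv x)))

/-- The free inverse monoid `FI(X)` on the set `X`. -/
def FreeInverseMonoid (X : Type u) : Type u := Quot (InverseTerm.Eqv (X := X))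

namespace FreeInverseMonoid

variable {X : Type u}

instance instInverseMonoid : InverseMonoid (FreeInverseMonoid X) where
  mul := Quot.map₂ .mul (fun _ _ _ h => .mul (.refl _) h) (fun _ _ _ h => .mul h (.refl _))
  one := Quot.mk _ .one
  inv := Quot.map .inv fun _ _ h => .inv h
  mul_assoc := by rintro ⟨x⟩ ⟨y⟩ ⟨z⟩; exact Quot.sound (.mul_assoc x y z)
  one_mul := by rintro ⟨x⟩; exact Quot.sound (.one_mul x)
  mul_one := by rintro ⟨x⟩; exact Quot.sound (.mul_one x)
  inv_inv' := by rintro ⟨x⟩; exact Quot.sound (.inv_inv x)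
  mul_inv_rev' := by rintro ⟨x⟩ ⟨y⟩; exact Quot.sound (.mul_inv_rev x y)
  mul_inv_mul_self := by rintro ⟨x⟩; exact Quot.sound (.mul_inv_mul_self x)
  mul_inv_comm := by rintro ⟨x⟩ ⟨y⟩; exact Quot.sound (.mul_inv_comm x y)

/-- The free generators. -/
def of (x : X) : FreeInverseMonoid X := Quot.mk _ (.var x)

end FreeInverseMonoid

/-! ## The expansions of a monoid

The free restriction (inverse) monoid on the bijective copy `M'` (`M''`) of the underlying set of
`M` is the free one on the type `M`. A set of relations on `FR(M')` is a binary relation on it. -/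

namespace MonoidExpansion

variable {M : Type u} [Monoid M]

/-- The relations that make the inclusion of generators a premorphism:
`⌊1⌋ = 1` and `⌊m⌋⌊n⌋ = (⌊m⌋⌊n⌋)^+ ⌊mn⌋`. -/
inductive PremorphismRel (M : Type u) [Monoid M] :
    FreeRestrictionMonoid M → FreeRestrictionMonoid M → Prop
  | one : PremorphismRel M (.of 1) 1
  | mul (m n : M) : PremorphismRel M (.of m * .of n) (rplus (.of m * .of n) * .of (m * n))

/-- The relations that make the inclusion of generators a homomorphism:
`⌊1⌋ = 1` and `⌊m⌋⌊n⌋ = ⌊mn⌋`. -/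
inductive HomRel (M : Type u) [Monoid M] :
    FreeRestrictionMonoid M → FreeRestrictionMonoid M → Prop
  | one : HomRel M (.of 1) 1
  | mul (m n : M) : HomRel M (.of m * .of n) (.of (m * n))

/-- Admissible relations: `R` yields the premorphism relations (they belong to `R` or follow
from it), and the homomorphism relations imply `R`. -/
structure Admissible (R : FreeRestrictionMonoid M → FreeRestrictionMonoid M → Prop) : Prop where
  premorphism : ∀ x y, PremorphismRel M x y → RestrictionMonoid.CongGen R x y
  of_hom : ∀ x y, R x y → RestrictionMonoid.CongGen (HomRel M) x y

/-- `FR_R(M)`: the restriction monoid generated by the `⌊m⌋`, `m ∈ M`, subject to `R`. -/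
abbrev FR (R : FreeRestrictionMonoid M → FreeRestrictionMonoid M → Prop) : Type u :=
  RestrictionMonoid.Presented R

/-- The generator `⌊m⌋` of `FR_R(M)`. -/
def FR.gen (R : FreeRestrictionMonoid M → FreeRestrictionMonoid M → Prop) (m : M) : FR R :=
  RestrictionMonoid.Presented.mk R (.of m)

/-- The canonical map `FR(M') → FI(M'')`, `⌊m⌋ ↦ [m]`, a homomorphism of restriction monoids. -/
def toFreeInverse (M : Type u) :
    RestrictionMonoidHom (FreeRestrictionMonoid M) (FreeInverseMonoid M) :=
  FreeRestrictionMonoid.lift FreeInverseMonoid.of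

/-- The inverse monoid relations on `FI(M'')` that are the images of the relations `R`. -/
def imageRel (R : FreeRestrictionMonoid M → FreeRestrictionMonoid M → Prop)
    (u v : FreeInverseMonoid M) : Prop :=
  ∃ x y, R x y ∧ toFreeInverse M x = u ∧ toFreeInverse M y = v

/-- `FI_R(M)`: the inverse monoid generated by the `[m]`, `m ∈ M`, subject to the image of `R`. -/
abbrev FI (R : FreeRestrictionMonoid M → FreeRestrictionMonoid M → Prop) : Type u :=
  InverseMonoid.Presented (imageRel R)

/-- The generator `[m]` of `FI_R(M)`. -/
def FI.gen (R : FreeRestrictionMonoid M → FreeRestrictionMonoid M → Prop) (m : M) : FI R :=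
  InverseMonoid.Presented.mk (imageRel R) (.of m)

end MonoidExpansion

/-! ## Restriction monoids: elementary facts -/

namespace RestrictionMonoid

variable {S : Type u} [RestrictionMonoid S]

/-! The canonical homomorphism from `FR R` to `FI R` is injective because an element is determined
by two pieces of data, both of which survive in `FI R`. The premorphism relations let every element
be written as a projection times one generator (`RestrictionMonoid.exists_proj_mul_eq`), so s =
s⁺⌊m⌋ for some m. It suffices to recover s⁺ and m from the image of s.

For s⁺, a restriction monoid acts on its projections by partial bijections p ↦ (xp)⁺. This Munn
representation (`RestrictionMonoid.munnHom`) takes values in an inverse monoid, so it factors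
through `FI R`, and it separates projections although it need not separate elements. For m, the
embedding of M into a group G satisfies (H), hence R, and so extends to `FI R`; idempotents go to 1,
so the image of s goes to the image of m in G. Together these give
`RestrictionMonoidHom.injective_of_munnHom`.

The image is the set of all e[m] because every idempotent of `FI R` is the image of a projection:
conjugation by a generator or its inverse keeps images of projections among themselves, and an
idempotent e equals e·1·e⁻¹ (`InverseMonoid.exists_proj_of_isIdempotentElem`).
`RestrictionMonoidHom.exists_range_eq` states this so that it applies both to `FR R` and directly to
the free restriction monoid on A, with the free group as G. -/

theorem rplus_one : rplus (1 : S) = 1 := by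
  simpa using rplus_mul_self (1 : S)

theorem rplus_rplus (x : S) : rplus (rplus x) = rplus x := by
  rw [← rstar_rplus x, rplus_rstar]

theorem rstar_eq_of_rplus_eq {p : S} (h : rplus p = p) : rstar p = p := by
  rw [← h, rstar_rplus]

/-- Moving y⁺ to the left through x gives (xy)⁺x⁺ = x⁺(xy)⁺ = (x⁺xy)⁺. This is what makes the
partial maps p ↦ (xp)⁺ compose correctly. -/
theorem rplus_mul_rplus (x y : S) : rplus (x * rplus y) = rplus (x * y) := by
  rw [mul_rplus, rplus_rplus_mul, rplus_comm, ← rplus_rplus_mul, ← mul_assoc, rplus_mul_self]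

theorem rplus_mul_eq_mul {p q : S} (hp : rplus p = p) (hq : rplus q = q) :
    rplus (p * q) = p * q := by
  conv_lhs => rw [← hp]
  rw [rplus_rplus_mul, hp, hq]

theorem mul_self_of_rplus_eq {p : S} (hp : rplus p = p) : p * p = p := by
  conv_lhs => rw [← hp]
  rw [hp]; conv_lhs => enter [1]; rw [← hp]
  exact rplus_mul_self p

theorem mul_comm_of_rplus_eq {p q : S} (hp : rplus p = p) (hq : rplus q = q) :
    p * q = q * p := by
  rw [← hp, ← hq, rplus_comm]

theorem rstar_mul_of_rplus_eq {p : S} (x : S) (hp : rplus p = p) :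
    rstar (x * p) = rstar x * p := by
  conv_lhs => rw [← rstar_eq_of_rplus_eq hp]
  rw [rstar_mul_rstar, rstar_eq_of_rplus_eq hp]

theorem rplus_mul_of_rplus_eq {p : S} (x : S) (hp : rplus p = p) :
    rplus (p * x) = p * rplus x := by
  conv_lhs => rw [← hp]
  rw [rplus_rplus_mul, hp]

/-! ### Projections and the identities behind the Munn representation. -/

/-- The projections of a restriction monoid. -/
abbrev Proj (S : Type u) [RestrictionMonoid S] : Type u := {p : S // rplus p = p}

/-- For a projection p one has (xp)⁺x = xp, whose star is x*p. Hence q ↦ (qx)* undoes p ↦ (xp)⁺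
below x*; the next lemma is the dual. -/
theorem rstar_rplus_mul_mul {x p : S} (hp : rplus p = p) (h : rstar x * p = p) :
    rstar (rplus (x * p) * x) = p := by
  rw [← mul_rplus, hp, rstar_mul_of_rplus_eq x hp, h]

theorem rplus_mul_rstar_mul {x q : S} (hq : rplus q = q) (h : rplus x * q = q) :
    rplus (x * rstar (q * x)) = q := by
  have := rstar_mul q x
  rw [rstar_eq_of_rplus_eq hq] at this
  rw [← this, rplus_mul_of_rplus_eq x hq, mul_comm_of_rplus_eq hq (rplus_rplus x), h]

/-- This says that the domain of the action of xy is the domain of the composite of the actions of y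
and x. It rests on x*(yp) = y(xy)*p and on (xy)* ≤ y*. -/
theorem rstar_mul_mul_eq_iff {x y p : S} (hp : rplus p = p) :
    rstar (x * y) * p = p ↔
      rstar y * p = p ∧ rstar x * rplus (y * p) = rplus (y * p) := by
  have key : rstar x * (y * p) = y * (rstar (x * y) * p) := by
    rw [← mul_assoc, rstar_mul, mul_assoc]
  have hle : rstar y * rstar (x * y) = rstar (x * y) := by
    rw [rstar_comm, ← rstar_mul_rstar, mul_assoc, mul_rstar_self]
  constructor
  · intro h
    refine ⟨?_, ?_⟩
    · rw [← h, ← mul_assoc, hle]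
    · rw [h] at key
      rw [← rplus_mul_of_rplus_eq _ (rplus_rstar x), key]
  · rintro ⟨h₁, h₂⟩
    -- Taking stars of this equation cancels y, since both (xy)*p and p lie below y*.
    have h₃ : y * (rstar (x * y) * p) = y * p := by
      rw [← key, ← rplus_mul_self (y * p), ← mul_assoc, h₂]
    have h₄ := congrArg rstar h₃
    rw [rstar_mul_of_rplus_eq y hp, rstar_mul_of_rplus_eq y
      (rplus_mul_eq_mul (rplus_rstar _) hp), ← mul_assoc, hle, h₁] at h₄
    exact h₄

end RestrictionMonoid

/-! ## Homomorphisms of restriction monoids -/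

namespace RestrictionMonoidHom

variable {S : Type u} {T : Type v} {U : Type w}
  [RestrictionMonoid S] [RestrictionMonoid T] [RestrictionMonoid U]

instance instMonoidHomClass : MonoidHomClass (RestrictionMonoidHom S T) S T where
  map_mul f := f.map_mul'
  map_one f := f.map_one'

theorem map_rstar (f : RestrictionMonoidHom S T) (x : S) : f (rstar x) = rstar (f x) :=
  f.map_rstar' x

theorem map_rplus (f : RestrictionMonoidHom S T) (x : S) : f (rplus x) = rplus (f x) :=
  f.map_rplus' x

/-- The composite of two homomorphisms. -/
def comp (g : RestrictionMonoidHom T U) (f : RestrictionMonoidHom S T) :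
    RestrictionMonoidHom S U where
  toFun x := g (f x)
  map_one' := by rw [map_one, map_one]
  map_mul' x y := by rw [map_mul, map_mul]
  map_rstar' x := by rw [map_rstar, map_rstar]
  map_rplus' x := by rw [map_rplus, map_rplus]

/-- The range of a homomorphism. -/
def range (f : RestrictionMonoidHom S T) : RestrictionSubmonoid T where
  carrier := Set.range f
  one_mem' := ⟨1, map_one f⟩
  mul_mem' := by rintro _ _ ⟨x, rfl⟩ ⟨y, rfl⟩; exact ⟨x * y, map_mul f x y⟩
  rstar_mem' := by rintro _ ⟨x, rfl⟩; exact ⟨rstar x, f.map_rstar x⟩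
  rplus_mem' := by rintro _ ⟨x, rfl⟩; exact ⟨rplus x, f.map_rplus x⟩

/-- A homomorphism, as a map onto its range. -/
def rangeRestrict (f : RestrictionMonoidHom S T) : RestrictionMonoidHom S f.range where
  toFun x := ⟨f x, x, rfl⟩
  map_one' := Subtype.ext (map_one f)
  map_mul' x y := Subtype.ext (map_mul f x y)
  map_rstar' x := Subtype.ext (f.map_rstar x)
  map_rplus' x := Subtype.ext (f.map_rplus x)

/-- The elements on which two homomorphisms agree. -/
def eqLocus (f g : RestrictionMonoidHom S T) : RestrictionSubmonoid S where
  carrier := {x | f x = g x}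
  one_mem' := (map_one f).trans (map_one g).symm
  mul_mem' {x y} hx hy := by
    change f (x * y) = g (x * y)
    rw [map_mul, map_mul, show f x = g x from hx, show f y = g y from hy]
  rstar_mem' {x} hx := by
    change f (rstar x) = g (rstar x)
    rw [map_rstar, map_rstar, show f x = g x from hx]
  rplus_mem' {x} hx := by
    change f (rplus x) = g (rplus x)
    rw [map_rplus, map_rplus, show f x = g x from hx]

/-- The preimage of a restriction submonoid. -/
def comap (f : RestrictionMonoidHom S T) (V : RestrictionSubmonoid T) :
    RestrictionSubmonoid S where
  carrier := {x | f x ∈ V}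
  one_mem' := by
    change f 1 ∈ V
    rw [map_one]; exact V.one_mem'
  mul_mem' {x y} hx hy := by
    change f (x * y) ∈ V
    rw [map_mul]; exact V.mul_mem' hx hy
  rstar_mem' {x} hx := by
    change f (rstar x) ∈ V
    rw [map_rstar]; exact V.rstar_mem' hx
  rplus_mem' {x} hx := by
    change f (rplus x) ∈ V
    rw [map_rplus]; exact V.rplus_mem' hx

end RestrictionMonoidHom

/-! ### Universal properties of free and presented restriction monoids. -/

theorem FreeRestrictionMonoid.mem_of_forall_of_mem {X : Type u}
    (V : RestrictionSubmonoid (FreeRestrictionMonoid X))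
    (h : ∀ x, FreeRestrictionMonoid.of x ∈ V) (s : FreeRestrictionMonoid X) : s ∈ V := by
  obtain ⟨t⟩ := s
  induction t with
  | var x => exact h x
  | one => exact V.one_mem'
  | mul _ _ hs ht => exact V.mul_mem' hs ht
  | star _ ht => exact V.rstar_mem' ht
  | plus _ ht => exact V.rplus_mem' ht

theorem FreeRestrictionMonoid.hom_ext {X : Type u} {S : Type v} [RestrictionMonoid S]
    {f g : RestrictionMonoidHom (FreeRestrictionMonoid X) S}
    (h : ∀ x, f (.of x) = g (.of x)) (s : FreeRestrictionMonoid X) : f s = g s :=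
  FreeRestrictionMonoid.mem_of_forall_of_mem (f.eqLocus g) h s

namespace RestrictionMonoid.Presented

variable {S : Type u} [RestrictionMonoid S] {r : S → S → Prop}

theorem _root_.RestrictionMonoid.CongGen.map_eq {T : Type v} [RestrictionMonoid T]
    (f : RestrictionMonoidHom S T) (h : ∀ x y, r x y → f x = f y) {x y : S}
    (hxy : RestrictionMonoid.CongGen r x y) : f x = f y := by
  induction hxy with
  | of hr => exact h _ _ hr
  | refl => rfl
  | symm _ ih => exact ih.symm
  | trans _ _ ih₁ ih₂ => exact ih₁.trans ih₂
  | mul _ _ ih₁ ih₂ => rw [map_mul, map_mul, ih₁, ih₂]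
  | rstar _ ih => rw [RestrictionMonoidHom.map_rstar, RestrictionMonoidHom.map_rstar, ih]
  | rplus _ ih => rw [RestrictionMonoidHom.map_rplus, RestrictionMonoidHom.map_rplus, ih]

variable (r) in
/-- The quotient map, as a homomorphism. -/
def mkHom : RestrictionMonoidHom S (RestrictionMonoid.Presented r) where
  toFun := mk r
  map_one' := rfl
  map_mul' _ _ := rfl
  map_rstar' _ := rfl
  map_rplus' _ := rfl

theorem mk_eq_of_congGen {x y : S} (h : RestrictionMonoid.CongGen r x y) : mk r x = mk r y :=
  Quot.sound h

/-- The homomorphism out of the quotient induced by one that respects the relations. -/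
def lift {T : Type v} [RestrictionMonoid T] (f : RestrictionMonoidHom S T)
    (h : ∀ x y, r x y → f x = f y) :
    RestrictionMonoidHom (RestrictionMonoid.Presented r) T where
  toFun := Quot.lift f fun _ _ hxy => hxy.map_eq f h
  map_one' := map_one f
  map_mul' := by rintro ⟨x⟩ ⟨y⟩; exact map_mul f x y
  map_rstar' := by rintro ⟨x⟩; exact f.map_rstar x
  map_rplus' := by rintro ⟨x⟩; exact f.map_rplus x

theorem mem_of_forall_mk_of_mem {X : Type u}
    {r : FreeRestrictionMonoid X → FreeRestrictionMonoid X → Prop}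
    (V : RestrictionSubmonoid (RestrictionMonoid.Presented r))
    (h : ∀ x, mk r (.of x) ∈ V) (s : RestrictionMonoid.Presented r) : s ∈ V := by
  obtain ⟨t⟩ := s
  exact FreeRestrictionMonoid.mem_of_forall_of_mem ((mkHom r).comap V) h t

end RestrictionMonoid.Presented

/-! ## Homomorphisms of inverse monoids -/

namespace InverseMonoid

theorem inv_one' {S : Type u} [InverseMonoid S] : (1 : S)⁻¹ = 1 := by
  simpa using mul_inv_mul_self (1 : S)

/-- Splitting the middle e of e⁻¹ee⁻¹ as ee and commuting e⁻¹e with ee⁻¹ turns e⁻¹ into ee⁻¹e⁻¹e,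
which is e because e⁻¹ is idempotent too. -/
theorem inv_eq_of_isIdempotentElem {S : Type u} [InverseMonoid S] {e : S}
    (h : IsIdempotentElem e) : e⁻¹ = e := by
  have h' : e⁻¹ * e⁻¹ = e⁻¹ := by rw [← mul_inv_rev', h.eq]
  calc e⁻¹ = e⁻¹ * e * e⁻¹ := (inv_mul_mul_inv e).symm
    _ = e⁻¹ * e * (e * e⁻¹) := by
        rw [mul_assoc, mul_assoc, ← mul_assoc e e, h.eq]
    _ = e * e⁻¹ * (e⁻¹ * e) := inv_mul_comm_mul_inv e e
    _ = e * (e⁻¹ * e⁻¹) * e := by simp only [mul_assoc]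
    _ = e := by rw [h', mul_inv_mul_self]

/-- A monoid homomorphism that respects inverses respects `^*` and `^+`. -/
def restrictionMonoidHom {S : Type u} {T : Type v} [InverseMonoid S] [InverseMonoid T]
    (f : S →* T) (h : ∀ x, f x⁻¹ = (f x)⁻¹) : RestrictionMonoidHom S T where
  toMonoidHom := f
  map_rstar' x := by
    change f (x⁻¹ * x) = (f x)⁻¹ * f x
    rw [map_mul, h]
  map_rplus' x := by
    change f (x * x⁻¹) = f x * (f x)⁻¹
    rw [map_mul, h]

namespace Presented

variable {S : Type u} [InverseMonoid S] {r : S → S → Prop}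

theorem _root_.InverseMonoid.CongGen.map_eq {T : Type v} [InverseMonoid T]
    (f : S →* T) (hf : ∀ x, f x⁻¹ = (f x)⁻¹) (h : ∀ x y, r x y → f x = f y) {x y : S}
    (hxy : InverseMonoid.CongGen r x y) : f x = f y := by
  induction hxy with
  | of hr => exact h _ _ hr
  | refl => rfl
  | symm _ ih => exact ih.symm
  | trans _ _ ih₁ ih₂ => exact ih₁.trans ih₂
  | mul _ _ ih₁ ih₂ => rw [map_mul, map_mul, ih₁, ih₂]
  | inv _ ih => rw [hf, hf, ih]

variable (r) in
/-- The quotient map, as a homomorphism. -/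
def mkHom : S →* InverseMonoid.Presented r where
  toFun := mk r
  map_one' := rfl
  map_mul' _ _ := rfl

/-- The homomorphism out of the quotient induced by one that respects the relations. -/
def lift {T : Type v} [InverseMonoid T] (f : S →* T) (hf : ∀ x, f x⁻¹ = (f x)⁻¹)
    (h : ∀ x y, r x y → f x = f y) : InverseMonoid.Presented r →* T where
  toFun := Quot.lift f fun _ _ hxy => hxy.map_eq f hf h
  map_one' := map_one f
  map_mul' := by rintro ⟨x⟩ ⟨y⟩; exact map_mul f x y

theorem lift_inv {T : Type v} [InverseMonoid T] (f : S →* T) (hf : ∀ x, f x⁻¹ = (f x)⁻¹)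
    (h : ∀ x y, r x y → f x = f y) (x : InverseMonoid.Presented r) :
    lift f hf h x⁻¹ = (lift f hf h x)⁻¹ := by
  obtain ⟨x⟩ := x; exact hf x

end Presented

end InverseMonoid

/-! ### Universal property of the free inverse monoid. -/

/-- The value of a term in an inverse monoid. -/
def InverseTerm.eval {X : Type u} {S : Type v} [InverseMonoid S] (f : X → S) :
    InverseTerm X → S
  | .var x => f x
  | .one => 1
  | .mul s t => s.eval f * t.eval f
  | .inv t => (t.eval f)⁻¹

theorem InverseTerm.Eqv.eval_eq {X : Type u} {S : Type v} [InverseMonoid S] (f : X → S)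
    {s t : InverseTerm X} (h : s.Eqv t) : s.eval f = t.eval f := by
  induction h with
  | refl => rfl
  | symm _ ih => exact ih.symm
  | trans _ _ ih₁ ih₂ => exact ih₁.trans ih₂
  | mul _ _ ih₁ ih₂ => simp only [InverseTerm.eval, ih₁, ih₂]
  | inv _ ih => simp only [InverseTerm.eval, ih]
  | mul_assoc => exact _root_.mul_assoc _ _ _
  | one_mul => exact _root_.one_mul _
  | mul_one => exact _root_.mul_one _
  | inv_inv => exact InverseMonoid.inv_inv' _
  | mul_inv_rev => exact InverseMonoid.mul_inv_rev' _ _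
  | mul_inv_mul_self => exact InverseMonoid.mul_inv_mul_self _
  | mul_inv_comm => exact InverseMonoid.mul_inv_comm _ _

namespace FreeInverseMonoid

variable {X : Type u}

/-- The homomorphism of inverse monoids that extends a map of the generators. -/
def lift {S : Type v} [InverseMonoid S] (f : X → S) : FreeInverseMonoid X →* S where
  toFun := Quot.lift (InverseTerm.eval f) fun _ _ h => h.eval_eq f
  map_one' := rfl
  map_mul' := by rintro ⟨x⟩ ⟨y⟩; rfl

theorem lift_inv {S : Type v} [InverseMonoid S] (f : X → S) (x : FreeInverseMonoid X) :
    lift f x⁻¹ = (lift f x)⁻¹ := by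
  obtain ⟨x⟩ := x; rfl

theorem induction {P : FreeInverseMonoid X → Prop} (of : ∀ x, P (of x)) (one : P 1)
    (mul : ∀ x y, P x → P y → P (x * y)) (inv : ∀ x, P x → P x⁻¹)
    (x : FreeInverseMonoid X) : P x := by
  obtain ⟨t⟩ := x
  induction t with
  | var x => exact of x
  | one => exact one
  | mul _ _ hs ht => exact mul _ _ hs ht
  | inv _ ht => exact inv _ ht

theorem hom_ext {S : Type v} [InverseMonoid S] {f g : FreeInverseMonoid X →* S}
    (hf : ∀ x, f x⁻¹ = (f x)⁻¹) (hg : ∀ x, g x⁻¹ = (g x)⁻¹)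
    (h : ∀ x, f (.of x) = g (.of x)) (s : FreeInverseMonoid X) : f s = g s :=
  induction (P := fun s => f s = g s) h (by rw [map_one, map_one])
    (fun x y hx hy => by rw [map_mul, map_mul, hx, hy])
    (fun x hx => by rw [hf, hg, hx]) s

end FreeInverseMonoid

/-- A group is an inverse monoid. -/
abbrev Group.toInverseMonoid (G : Type u) [Group G] : InverseMonoid G where
  inv_inv' := inv_inv
  mul_inv_rev' := mul_inv_rev
  mul_inv_mul_self x := by simp
  mul_inv_comm x y := by simp

/-! ## The symmetric inverse monoid and the Munn representation -/

/-- The symmetric inverse monoid on a set: partial bijections, composed from right to left. -/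
def SymmetricInverseMonoid (P : Type u) : Type u := P ≃. P

theorem PEquiv.trans_symm_eq_some {α : Type u} {β : Type v} (f : α ≃. β) (a b : α) :
    f.trans f.symm a = some b ↔ a = b ∧ ∃ c, f a = some c := by
  rw [PEquiv.trans_eq_some]
  constructor
  · rintro ⟨c, h₁, h₂⟩
    rw [PEquiv.eq_some_iff] at h₂
    exact ⟨f.inj h₁ h₂, c, h₁⟩
  · rintro ⟨rfl, c, h⟩
    exact ⟨c, h, f.eq_some_iff.2 h⟩

theorem PEquiv.ext_some {α : Type u} {β : Type v} {f g : α ≃. β}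
    (h : ∀ a b, f a = some b ↔ g a = some b) : f = g :=
  PEquiv.ext fun a => Option.ext (h a)

instance SymmetricInverseMonoid.instInverseMonoid (P : Type u) :
    InverseMonoid (SymmetricInverseMonoid P) where
  mul f g := PEquiv.trans g f
  one := PEquiv.refl P
  inv f := PEquiv.symm f
  mul_assoc f g h := PEquiv.trans_assoc h g f |>.symm
  one_mul f := PEquiv.trans_refl f
  mul_one f := PEquiv.refl_trans f
  inv_inv' f := PEquiv.symm_symm f
  mul_inv_rev' f g := PEquiv.symm_trans_rev g f
  mul_inv_mul_self f := by
    -- Products compose from right to left, so this is f f⁻¹ f with the product unfolded.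
    have key (f : P ≃. P) : f.trans (f.symm.trans f) = f := by
      refine PEquiv.ext_some fun a b => ?_
      rw [← PEquiv.trans_assoc, PEquiv.trans_eq_some]
      constructor
      · rintro ⟨c, h₁, h₂⟩
        rw [PEquiv.trans_symm_eq_some] at h₁
        rw [h₁.1]; exact h₂
      · intro h
        exact ⟨a, (PEquiv.trans_symm_eq_some _ _ _).2 ⟨rfl, b, h⟩, h⟩
    exact key f
  mul_inv_comm f g := by
    -- Each factor is the identity on a range, so the composite is the identity on the intersection
    -- of the two ranges, a condition symmetric in f and g.
    have key (f g : P ≃. P) (a b : P) :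
        (f.symm.trans f).trans (g.symm.trans g) a = some b ↔
          a = b ∧ (∃ c, f.symm a = some c) ∧ ∃ c, g.symm a = some c := by
      have hf := fun a b => PEquiv.trans_symm_eq_some f.symm a b
      have hg := fun a b => PEquiv.trans_symm_eq_some g.symm a b
      rw [PEquiv.symm_symm] at hf hg
      rw [PEquiv.trans_eq_some]
      constructor
      · rintro ⟨c, h₁, h₂⟩
        rw [hf] at h₁
        rw [hg] at h₂
        obtain ⟨rfl, h₁⟩ := h₁
        exact ⟨h₂.1, h₁, h₂.2⟩
      · rintro ⟨rfl, h₁, h₂⟩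
        exact ⟨a, (hf _ _).2 ⟨rfl, h₁⟩, (hg _ _).2 ⟨rfl, h₂⟩⟩
    refine PEquiv.ext_some fun a b => ?_
    exact (key g f a b).trans (((and_congr_right fun _ => and_comm)).trans (key f g a b).symm)

namespace RestrictionMonoid

variable {S : Type u} [RestrictionMonoid S]

open Classical in
/-- The partial bijection `p ↦ (xp)^+` from the projections below `x^*` to those below `x^+`. -/
noncomputable def munn (x : S) : Proj S ≃. Proj S where
  toFun p := if rstar x * p.1 = p.1 then some ⟨rplus (x * p.1), rplus_rplus _⟩ else none
  invFun q := if rplus x * q.1 = q.1 then some ⟨rstar (q.1 * x), rplus_rstar _⟩ else none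
  inv := by
    rintro ⟨p, hp⟩ ⟨q, hq⟩
    simp only [Option.ite_none_right_eq_some, Option.some.injEq, Subtype.mk.injEq]
    constructor
    · rintro ⟨h, rfl⟩
      refine ⟨?_, rplus_mul_rstar_mul hq h⟩
      have := rstar_mul q x
      rw [rstar_eq_of_rplus_eq hq] at this
      rw [← rstar_mul_rstar, ← this]
    · rintro ⟨h, rfl⟩
      refine ⟨?_, rstar_rplus_mul_mul hp h⟩
      rw [← rplus_rplus_mul, ← mul_assoc, rplus_mul_self]

theorem munn_eq_some {x : S} {p q : Proj S} :
    munn x p = some q ↔ rstar x * p.1 = p.1 ∧ rplus (x * p.1) = q.1 := by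
  obtain ⟨q, hq⟩ := q
  simp only [munn, PEquiv.coe_mk, Option.ite_none_right_eq_some, Option.some.injEq, Subtype.mk.injEq]

theorem munn_symm_eq_some {x : S} {p q : Proj S} :
    (munn x).symm p = some q ↔ rplus x * p.1 = p.1 ∧ rstar (p.1 * x) = q.1 := by
  obtain ⟨q, hq⟩ := q
  simp only [munn, PEquiv.symm, PEquiv.coe_mk, Option.ite_none_right_eq_some, Option.some.injEq, Subtype.mk.injEq]

/-- A projection acts as the identity on the projections below it, because ep = p gives (ep)⁺ = p.
-/
theorem munn_of_rplus_eq {e : S} (he : rplus e = e) {p q : Proj S} :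
    munn e p = some q ↔ p = q ∧ e * p.1 = p.1 := by
  rw [munn_eq_some, rstar_eq_of_rplus_eq he, Subtype.ext_iff]
  constructor
  · rintro ⟨h, h'⟩
    rw [h, p.2] at h'
    exact ⟨h', h⟩
  · rintro ⟨h', h⟩
    rw [h, p.2]
    exact ⟨rfl, h'⟩

variable (S) in
/-- The Munn representation of a restriction monoid. -/
noncomputable def munnHom : RestrictionMonoidHom S (SymmetricInverseMonoid (Proj S)) where
  toFun := munn
  map_one' := PEquiv.ext_some fun p q => by
    change _ ↔ some p = some q
    rw [munn_of_rplus_eq rplus_one, Option.some.injEq]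
    simp
  map_mul' x y := PEquiv.ext_some fun p q => by
    change _ ↔ (munn y).trans (munn x) p = some q
    rw [PEquiv.trans_eq_some, munn_eq_some, rstar_mul_mul_eq_iff p.2]
    constructor
    · rintro ⟨⟨h₁, h₂⟩, h₃⟩
      refine ⟨⟨_, rplus_rplus (y * p.1)⟩, munn_eq_some.2 ⟨h₁, rfl⟩, munn_eq_some.2 ⟨h₂, ?_⟩⟩
      rw [rplus_mul_rplus, ← mul_assoc, h₃]
    · rintro ⟨r, h₁, h₂⟩
      rw [munn_eq_some] at h₁ h₂
      rw [← h₁.2, rplus_mul_rplus, ← mul_assoc] at h₂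
      exact ⟨⟨h₁.1, h₂.1⟩, h₂.2⟩
  map_rstar' x := PEquiv.ext_some fun p q => by
    change _ ↔ (munn x).trans (munn x).symm p = some q
    rw [PEquiv.trans_symm_eq_some, munn_of_rplus_eq (rplus_rstar x)]
    refine and_congr_right fun _ => ⟨fun h => ⟨⟨rplus (x * p.1), rplus_rplus _⟩, munn_eq_some.2 ⟨h, rfl⟩⟩, ?_⟩
    rintro ⟨c, h⟩
    exact (munn_eq_some.1 h).1
  map_rplus' x := PEquiv.ext_some fun p q => by
    change _ ↔ (munn x).symm.trans (munn x).symm.symm p = some q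
    rw [PEquiv.trans_symm_eq_some, munn_of_rplus_eq (rplus_rplus x)]
    refine and_congr_right fun _ => ⟨fun h => ⟨⟨rstar (p.1 * x), rplus_rstar _⟩, munn_symm_eq_some.2 ⟨h, rfl⟩⟩, ?_⟩
    rintro ⟨c, h⟩
    exact (munn_symm_eq_some.1 h).1

/-- The action of e is the identity on the projections below e, and e is the largest of them. Equal
actions therefore give e ≤ f and f ≤ e. -/
theorem munnHom_injOn_proj {e f : S} (he : rplus e = e) (hf : rplus f = f)
    (h : munnHom S e = munnHom S f) : e = f := by
  have key {e f : S} (he : rplus e = e) (hf : rplus f = f)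
      (h : munn e = munn f) : f * e = e := by
    have := (munn_of_rplus_eq he (p := ⟨e, he⟩)).2 ⟨rfl, mul_self_of_rplus_eq he⟩
    rw [h] at this
    exact ((munn_of_rplus_eq hf).1 this).2
  rw [← key he hf h, mul_comm_of_rplus_eq hf he, key hf he h.symm]

end RestrictionMonoid

/-! ## Restriction monoids covered by a premorphism -/

section Cover

variable {S : Type*} [RestrictionMonoid S] {N : Type*} {θ : N → S}

/-- The products pθ(n) form a restriction submonoid containing the generators. Projections have this
form since θ(1) = 1, and in a product θ(m)q = (θ(m)q)⁺θ(m) moves the inner projection to the left.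
-/
theorem RestrictionMonoid.exists_proj_mul_eq [Monoid N] {X : Type*} {g : X → S}
    (hone : θ 1 = 1) (hmul : ∀ m n, ∃ p, rplus p = p ∧ θ m * θ n = p * θ (m * n))
    (hg : ∀ x, ∃ n, g x = θ n)
    (hgen : ∀ V : RestrictionSubmonoid S, (∀ x, g x ∈ V) → ∀ s, s ∈ V) (s : S) :
    ∃ p n, rplus p = p ∧ s = p * θ n := by
  let V : RestrictionSubmonoid S :=
    { carrier := {s | ∃ p n, rplus p = p ∧ s = p * θ n}
      one_mem' := ⟨1, 1, rplus_one, by rw [hone, one_mul]⟩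
      mul_mem' := by
        rintro _ _ ⟨p, m, hp, rfl⟩ ⟨q, n, hq, rfl⟩
        obtain ⟨r, hr, hmn⟩ := hmul m n
        refine ⟨p * rplus (θ m * q) * r, m * n,
          rplus_mul_eq_mul (rplus_mul_eq_mul hp (rplus_rplus _)) hr, ?_⟩
        have h := mul_rplus (θ m) q
        rw [hq] at h
        calc p * θ m * (q * θ n) = p * (θ m * q) * θ n := by simp only [mul_assoc]
          _ = p * (rplus (θ m * q) * θ m) * θ n := by rw [← h]
          _ = p * rplus (θ m * q) * (θ m * θ n) := by simp only [mul_assoc]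
          _ = _ := by rw [hmn]; simp only [mul_assoc]
      rstar_mem' := fun {s} _ => ⟨rstar s, 1, rplus_rstar s, by rw [hone, mul_one]⟩
      rplus_mem' := fun {s} _ => ⟨rplus s, 1, rplus_rplus s, by rw [hone, mul_one]⟩ }
  refine hgen V (fun x => ?_) s
  obtain ⟨n, hn⟩ := hg x
  exact ⟨1, n, rplus_one, by rw [hn, one_mul]⟩

/-! ### Injectivity and image of a homomorphism into an inverse monoid. -/

variable {I : Type*} [InverseMonoid I] {φ : RestrictionMonoidHom S I}

/-- Since s = s⁺θ(n), it is enough that φ(s) determines s⁺, through the Munn representation, and n,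
through the group. -/
theorem RestrictionMonoidHom.injective_of_munnHom {G : Type*} [Group G]
    (hcov : ∀ s : S, ∃ p n, rplus p = p ∧ s = p * θ n)
    {ψ : I → SymmetricInverseMonoid (RestrictionMonoid.Proj S)}
    (hψ : ∀ s, ψ (φ s) = RestrictionMonoid.munnHom S s)
    {κ : I →* G} {j : N → G} (hj : Function.Injective j) (hκ : ∀ n, κ (φ (θ n)) = j n) :
    Function.Injective φ := by
  intro s t h
  have hplus : rplus s = rplus t := by
    refine RestrictionMonoid.munnHom_injOn_proj (RestrictionMonoid.rplus_rplus s)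
      (RestrictionMonoid.rplus_rplus t) ?_
    rw [← hψ, ← hψ, φ.map_rplus, φ.map_rplus, h]
  -- The only idempotent of a group is 1.
  have hproj (p : S) (hp : rplus p = p) : κ (φ p) = 1 := by
    have := congrArg (fun x => κ (φ x)) (RestrictionMonoid.mul_self_of_rplus_eq hp)
    simpa using this
  have hs (p : S) (n : N) (hp : rplus p = p) : p * θ n = rplus (p * θ n) * θ n := by
    rw [RestrictionMonoid.rplus_mul_of_rplus_eq _ hp, mul_assoc,
      RestrictionMonoid.rplus_mul_self]
  obtain ⟨p, m, hp, rfl⟩ := hcov s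
  obtain ⟨q, n, hq, rfl⟩ := hcov t
  have hmn := congrArg κ h
  rw [map_mul, map_mul, map_mul, map_mul, hproj p hp, hproj q hq, hκ, hκ, one_mul,
    one_mul] at hmn
  rw [hs p m hp, hs q n hq, hplus, hj hmn]

/-- For a in S, conjugating φ(p) by φ(a) gives φ((ap)⁺), and by its inverse φ((pa)*). Hence images
of projections are stable under conjugation by everything that the φ(g x) generate as an inverse
monoid. -/
theorem InverseMonoid.exists_proj_of_isIdempotentElem {X : Type*} {g : X → S}
    (hind : ∀ Q : I → Prop, Q 1 → (∀ x y, Q x → Q y → Q (x * y)) → (∀ x, Q x → Q x⁻¹) →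
      (∀ x, Q (φ (g x))) → ∀ y, Q y) {e : I} (he : IsIdempotentElem e) :
    ∃ p, rplus p = p ∧ φ p = e := by
  have conj (a p : S) (hp : rplus p = p) : φ (rplus (a * p)) = φ a * φ p * (φ a)⁻¹ := by
    have h : φ p * (φ p)⁻¹ = φ p := by
      conv_rhs => rw [← hp, φ.map_rplus]
      rfl
    rw [φ.map_rplus, map_mul]
    change φ a * φ p * (φ a * φ p)⁻¹ = _
    rw [mul_inv_rev', mul_assoc, ← mul_assoc (φ p), h, mul_assoc]
  have conj' (a p : S) (hp : rplus p = p) : φ (rstar (p * a)) = (φ a)⁻¹ * φ p * φ a := by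
    have h : (φ p)⁻¹ * φ p = φ p := by
      conv_rhs => rw [← RestrictionMonoid.rstar_eq_of_rplus_eq hp, φ.map_rstar]
      rfl
    rw [φ.map_rstar, map_mul]
    change (φ p * φ a)⁻¹ * (φ p * φ a) = _
    rw [mul_inv_rev', mul_assoc, ← mul_assoc _ (φ p), h, mul_assoc]
  -- Both conjugations are carried along so that the induction passes from y to y⁻¹ by swapping
  -- them.
  have key : ∀ y : I, ∀ p, rplus p = p →
      (∃ q, rplus q = q ∧ φ q = y * φ p * y⁻¹) ∧ ∃ q, rplus q = q ∧ φ q = y⁻¹ * φ p * y := by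
    refine hind _ (fun p hp => ?_) (fun x y hx hy p hp => ?_) (fun x hx p hp => ?_)
      (fun x p hp => ?_)
    · rw [inv_one', one_mul, mul_one]
      exact ⟨⟨p, hp, rfl⟩, p, hp, rfl⟩
    · obtain ⟨q, hq, h₁⟩ := (hy p hp).1
      obtain ⟨q', hq', h₁'⟩ := (hx q hq).1
      obtain ⟨r, hr, h₂⟩ := (hx p hp).2
      obtain ⟨r', hr', h₂'⟩ := (hy r hr).2
      refine ⟨⟨q', hq', ?_⟩, r', hr', ?_⟩
      · rw [h₁', h₁, mul_inv_rev']; simp only [mul_assoc]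
      · rw [h₂', h₂, mul_inv_rev']; simp only [mul_assoc]
    · rw [inv_inv']
      exact (hx p hp).symm
    · exact ⟨⟨_, RestrictionMonoid.rplus_rplus _, conj _ p hp⟩,
        _, RestrictionMonoid.rplus_rstar _, conj' _ p hp⟩
  -- Conjugating 1 by e gives ee⁻¹, which is e for an idempotent.
  obtain ⟨q, hq, h⟩ := (key e 1 RestrictionMonoid.rplus_one).1
  refine ⟨q, hq, ?_⟩
  rw [h, map_one, mul_one, inv_eq_of_isIdempotentElem he, he.eq]

/-- The generators g and the covering family θ are kept apart: they coincide for `FR R`, whereas for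
the free restriction monoid on A the generators are letters and θ evaluates words. -/
theorem RestrictionMonoidHom.exists_range_eq [Monoid N] {X : Type*} {G : Type*} [Group G] {g : X → S}
    (hone : θ 1 = 1) (hmul : ∀ m n, ∃ p, rplus p = p ∧ θ m * θ n = p * θ (m * n))
    (hg : ∀ x, ∃ n, g x = θ n) (hcl : ∀ n, θ n ∈ Submonoid.closure (Set.range g))
    (hgen : ∀ V : RestrictionSubmonoid S, (∀ x, g x ∈ V) → ∀ s, s ∈ V)
    (hind : ∀ Q : I → Prop, Q 1 → (∀ x y, Q x → Q y → Q (x * y)) → (∀ x, Q x → Q x⁻¹) →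
      (∀ x, Q (φ (g x))) → ∀ y, Q y)
    {ψ : I → SymmetricInverseMonoid (RestrictionMonoid.Proj S)}
    (hψ : ∀ s, ψ (φ s) = RestrictionMonoid.munnHom S s)
    {κ : I →* G} {j : N → G} (hj : Function.Injective j) (hκ : ∀ n, κ (φ (θ n)) = j n)
    {i : X → I} (hi : ∀ x, φ (g x) = i x) {t : N → I} (ht : ∀ n, φ (θ n) = t n) :
    ∃ T : RestrictionSubmonoid I,
      (T : Set I) = {x | ∃ (e : I) (n : N), IsIdempotentElem e ∧ x = e * t n} ∧
      (∃ γ : RestrictionMonoidHom S T, Function.Bijective γ ∧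
        ∀ x, (γ (g x) : I) = i x) ∧
      T = RestrictionSubmonoid.closure (Set.range i) ∧
      T.toSubmonoid = Submonoid.closure ({e | IsIdempotentElem e} ∪ Set.range i) := by
  have hcov := RestrictionMonoid.exists_proj_mul_eq hone hmul hg hgen
  have hinj := RestrictionMonoidHom.injective_of_munnHom hcov hψ hj hκ
  have hidem {p : S} (hp : rplus p = p) : IsIdempotentElem (φ p) := by
    rw [IsIdempotentElem, ← map_mul, RestrictionMonoid.mul_self_of_rplus_eq hp]
  refine ⟨φ.range, ?_, ⟨φ.rangeRestrict, ⟨?_, ?_⟩, hi⟩, ?_, ?_⟩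
  · refine Set.Subset.antisymm ?_ ?_
    · rintro _ ⟨s, rfl⟩
      obtain ⟨p, n, hp, rfl⟩ := hcov s
      exact ⟨φ p, n, hidem hp, by rw [map_mul, ht]⟩
    · rintro _ ⟨e, n, he, rfl⟩
      obtain ⟨p, -, rfl⟩ := InverseMonoid.exists_proj_of_isIdempotentElem hind he
      exact ⟨p * θ n, by rw [map_mul, ht]⟩
  · exact fun s s' h => hinj (congrArg Subtype.val h)
  · rintro ⟨_, s, rfl⟩
    exact ⟨s, rfl⟩
  · refine SetLike.coe_injective (Set.Subset.antisymm ?_ ?_)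
    · rintro _ ⟨s, rfl⟩ V hV
      refine hgen (φ.comap V) (fun x => ?_) s
      change φ (g x) ∈ V
      rw [hi]
      exact hV ⟨x, rfl⟩
    · intro y hy
      refine hy φ.range ?_
      rintro _ ⟨x, rfl⟩
      exact ⟨g x, hi x⟩
  · refine le_antisymm ?_ (Submonoid.closure_le.2 ?_)
    · rintro _ ⟨s, rfl⟩
      obtain ⟨p, n, hp, rfl⟩ := hcov s
      rw [map_mul]
      refine mul_mem (Submonoid.subset_closure (Or.inl (hidem hp))) ?_
      refine (Submonoid.closure_le (S := (Submonoid.closure _).comap φ.toMonoidHom)).2 ?_ (hcl n)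
      rintro _ ⟨x, rfl⟩
      exact Submonoid.subset_closure (Or.inr ⟨x, (hi x).symm⟩)
    · rintro y (he | ⟨x, rfl⟩)
      · obtain ⟨p, -, rfl⟩ := InverseMonoid.exists_proj_of_isIdempotentElem hind he
        exact ⟨p, rfl⟩
      · exact ⟨g x, hi x⟩

end Cover

/-! ## The expansions of a monoid that embeds into a group -/

namespace MonoidExpansion

section Embeds

variable {M : Type u}
  {R : FreeRestrictionMonoid M → FreeRestrictionMonoid M → Prop}

/-- Both sides are homomorphisms of restriction monoids that agree on generators. Thus every such
homomorphism into an inverse monoid factors through the free inverse monoid. -/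
theorem lift_toFreeInverse {S : Type v} [InverseMonoid S] (f : RestrictionMonoidHom
    (FreeRestrictionMonoid M) S) (x : FreeRestrictionMonoid M) :
    FreeInverseMonoid.lift (fun m => f (.of m)) (toFreeInverse M x) = f x :=
  FreeRestrictionMonoid.hom_ext
    (f := (InverseMonoid.restrictionMonoidHom (FreeInverseMonoid.lift fun m => f (.of m))
      (FreeInverseMonoid.lift_inv _)).comp (toFreeInverse M)) (g := f) (fun _ => rfl) x

/-- The homomorphism `FI_R(M) → S` of inverse monoids induced by a homomorphism
`FR(M') → S` of restriction monoids that respects `R`. -/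
def FI.lift {S : Type v} [InverseMonoid S]
    (f : RestrictionMonoidHom (FreeRestrictionMonoid M) S) (h : ∀ x y, R x y → f x = f y) :
    FI R →* S :=
  InverseMonoid.Presented.lift (FreeInverseMonoid.lift fun m => f (.of m))
    (FreeInverseMonoid.lift_inv _) (by
      rintro _ _ ⟨x, y, hxy, rfl, rfl⟩
      rw [lift_toFreeInverse, lift_toFreeInverse, h x y hxy])

theorem FI.lift_inv {S : Type v} [InverseMonoid S]
    (f : RestrictionMonoidHom (FreeRestrictionMonoid M) S) (h : ∀ x y, R x y → f x = f y)
    (x : FI R) : FI.lift f h x⁻¹ = (FI.lift f h x)⁻¹ :=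
  InverseMonoid.Presented.lift_inv _ _ _ x

theorem FI.induction {P : FI R → Prop} (one : P 1)
    (mul : ∀ x y, P x → P y → P (x * y)) (inv : ∀ x, P x → P x⁻¹)
    (gen : ∀ m, P (FI.gen R m)) (x : FI R) : P x := by
  obtain ⟨x⟩ := x
  exact FreeInverseMonoid.induction (P := fun x => P (Quot.mk _ x)) gen one
    (fun x y hx hy => mul _ _ hx hy) (fun x hx => inv _ hx) x

variable (R) in
/-- The canonical homomorphism `FR_R(M) → FI_R(M)`, `⌊m⌋ ↦ [m]`. -/
def FR.toFI : RestrictionMonoidHom (FR R) (FI R) :=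
  RestrictionMonoid.Presented.lift
    ((InverseMonoid.restrictionMonoidHom (InverseMonoid.Presented.mkHom (imageRel R))
      fun _ => rfl).comp (toFreeInverse M))
    fun x y hxy => Quot.sound (.of ⟨x, y, hxy, rfl, rfl⟩)

theorem FR.toFI_gen (m : M) : FR.toFI R (FR.gen R m) = FI.gen R m :=
  rfl

theorem FR.gen_one [Monoid M] (hR : Admissible R) : FR.gen R 1 = 1 :=
  RestrictionMonoid.Presented.mk_eq_of_congGen (hR.premorphism _ _ .one)

theorem FR.gen_mul [Monoid M] (hR : Admissible R) (m n : M) : FR.gen R m * FR.gen R n =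
    rplus (FR.gen R m * FR.gen R n) * FR.gen R (m * n) :=
  RestrictionMonoid.Presented.mk_eq_of_congGen (hR.premorphism _ _ (.mul m n))

theorem FR.hom_ext {S : Type v} [RestrictionMonoid S] {f g : RestrictionMonoidHom (FR R) S}
    (h : ∀ m, f (FR.gen R m) = g (FR.gen R m)) (s : FR R) : f s = g s :=
  RestrictionMonoid.Presented.mem_of_forall_mk_of_mem (f.eqLocus g) h s

theorem FI.lift_toFI {S : Type v} [InverseMonoid S] (f : RestrictionMonoidHom (FR R) S)
    (h : ∀ x y, R x y → f.comp (RestrictionMonoid.Presented.mkHom R) x =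
      f.comp (RestrictionMonoid.Presented.mkHom R) y) (s : FR R) :
    FI.lift (f.comp (RestrictionMonoid.Presented.mkHom R)) h (FR.toFI R s) = f s :=
  FR.hom_ext (f := (InverseMonoid.restrictionMonoidHom _
    (FI.lift_inv (f.comp (RestrictionMonoid.Presented.mkHom R)) h)).comp (FR.toFI R))
    (g := f) (fun _ => rfl) s

theorem exists_FR_iso_FI [Monoid M] {G : Type v} [Group G] (j : M →* G) (hj : Function.Injective j)
    (hR : Admissible R) :
    ∃ T : RestrictionSubmonoid (FI R),
      (T : Set (FI R)) = {x | ∃ (e : FI R) (m : M), IsIdempotentElem e ∧ x = e * FI.gen R m} ∧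
      (∃ φ : RestrictionMonoidHom (FR R) T, Function.Bijective φ ∧
        ∀ m : M, (φ (FR.gen R m) : FI R) = FI.gen R m) ∧
      T = RestrictionSubmonoid.closure (Set.range (FI.gen R)) ∧
      T.toSubmonoid = Submonoid.closure ({e | IsIdempotentElem e} ∪ Set.range (FI.gen R)) := by
  let := Group.toInverseMonoid G
  -- Admissibility reduces R to (H), and (H) holds in G because j is a monoid homomorphism.
  have hG (x y) (h : R x y) : FreeRestrictionMonoid.lift j x = FreeRestrictionMonoid.lift j y := by
    refine (hR.of_hom x y h).map_eq _ ?_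
    rintro _ _ (_ | ⟨m, n⟩)
    · exact map_one j
    · exact (map_mul j m n).symm
  have hM (x y) (h : R x y) :
      (RestrictionMonoid.munnHom (FR R)).comp (RestrictionMonoid.Presented.mkHom R) x =
      (RestrictionMonoid.munnHom (FR R)).comp (RestrictionMonoid.Presented.mkHom R) y :=
    congrArg (RestrictionMonoid.munnHom (FR R)) (Quot.sound (.of h))
  exact RestrictionMonoidHom.exists_range_eq (θ := FR.gen R) (g := FR.gen R) (φ := FR.toFI R)
    (FR.gen_one hR)
    (fun m n => ⟨_, RestrictionMonoid.rplus_rplus _, FR.gen_mul hR m n⟩)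
    (fun m => ⟨m, rfl⟩) (fun m => Submonoid.subset_closure ⟨m, rfl⟩)
    (RestrictionMonoid.Presented.mem_of_forall_mk_of_mem)
    (fun _ h₁ h₂ h₃ h₄ => FI.induction h₁ h₂ h₃ h₄)
    (FI.lift_toFI (RestrictionMonoid.munnHom (FR R)) hM)
    (κ := FI.lift (FreeRestrictionMonoid.lift j) hG) hj (fun _ => rfl)
    (fun _ => rfl) (fun _ => rfl)

end Embeds

/-! ## Free monoids -/

theorem admissible_homRel (M : Type u) [Monoid M] : Admissible (HomRel M) where
  premorphism := by
    rintro _ _ (_ | ⟨m, n⟩)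
    · exact .of .one
    -- Multiplying ⌊m⌋⌊n⌋ = ⌊mn⌋ on the left by (⌊m⌋⌊n⌋)⁺ leaves its left side unchanged.
    · have h := RestrictionMonoid.CongGen.mul
        (.refl (rplus (FreeRestrictionMonoid.of m * .of n))) (.of (HomRel.mul m n))
      rwa [RestrictionMonoid.rplus_mul_self] at h
  of_hom _ _ h := .of h

/-! ### Identification with the free objects on A, and the embedding into the free group. -/

variable {A : Type w}

theorem map_freeMonoid_lift {S : Type u} {T : Type v} [Monoid S] [Monoid T] {F : Type*}
    [FunLike F S T] [MonoidHomClass F S T] (f : F) (g : A → S) (v : FreeMonoid A) :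
    f (FreeMonoid.lift g v) = FreeMonoid.lift (fun a => f (g a)) v := by
  induction v using FreeMonoid.inductionOn' with
  | one => rw [map_one, map_one, map_one]
  | of_mul a v ih => rw [map_mul, map_mul, map_mul, ih, FreeMonoid.lift_eval_of,
      FreeMonoid.lift_eval_of]

/-- Under (H) the map v ↦ ⌊v⌋ is a monoid homomorphism, hence determined by the letters. -/
theorem FR.freeMonoid_lift_gen (v : FreeMonoid A) :
    FreeMonoid.lift (fun a => FR.gen (HomRel (FreeMonoid A)) (FreeMonoid.of a)) v =
      FR.gen _ v := by
  induction v using FreeMonoid.inductionOn' with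
  | one =>
    rw [map_one]
    exact (FR.gen_one (admissible_homRel _)).symm
  | of_mul a v ih =>
    rw [map_mul, ih, FreeMonoid.lift_eval_of]
    exact RestrictionMonoid.Presented.mk_eq_of_congGen (.of (.mul _ _))

theorem exists_FR_iso_freeRestrictionMonoid (A : Type w) :
    ∃ α : RestrictionMonoidHom (FR (HomRel (FreeMonoid A))) (FreeRestrictionMonoid A),
      Function.Bijective α ∧
      ∀ a : A, α (FR.gen _ (FreeMonoid.of a)) = FreeRestrictionMonoid.of a := by
  let f := FreeRestrictionMonoid.lift
    (FreeMonoid.lift (FreeRestrictionMonoid.of : A → FreeRestrictionMonoid A))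
  have hf (x y) (h : HomRel (FreeMonoid A) x y) : f x = f y := by
    obtain _ | ⟨m, n⟩ := h
    · exact map_one (FreeMonoid.lift FreeRestrictionMonoid.of)
    · exact (map_mul (FreeMonoid.lift FreeRestrictionMonoid.of) m n).symm
  let α := RestrictionMonoid.Presented.lift f hf
  have hα (v) : α (FR.gen _ v) = FreeMonoid.lift FreeRestrictionMonoid.of v := rfl
  let β : RestrictionMonoidHom (FreeRestrictionMonoid A) (FR (HomRel (FreeMonoid A))) :=
    FreeRestrictionMonoid.lift fun a => FR.gen _ (FreeMonoid.of a)
  have hβ (a) : β (.of a) = FR.gen _ (FreeMonoid.of a) := rfl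
  refine ⟨α, Function.bijective_iff_has_inverse.2 ⟨β, fun s => ?_, fun s => ?_⟩, fun a => ?_⟩
  · refine FR.hom_ext (f := β.comp α) (g := RestrictionMonoidHom.comp ⟨MonoidHom.id _,
      fun _ => rfl, fun _ => rfl⟩ ⟨MonoidHom.id _, fun _ => rfl, fun _ => rfl⟩) (fun v => ?_) s
    change β (α _) = FR.gen _ v
    rw [hα, map_freeMonoid_lift]
    exact FR.freeMonoid_lift_gen v
  · refine FreeRestrictionMonoid.hom_ext (f := α.comp β) (g := ⟨MonoidHom.id _,
      fun _ => rfl, fun _ => rfl⟩) (fun a => ?_) s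
    change α (β (.of a)) = .of a
    rw [hβ, hα, FreeMonoid.lift_eval_of]
  · rw [hα, FreeMonoid.lift_eval_of]

theorem exists_FI_mulEquiv_freeInverseMonoid (A : Type w) :
    ∃ β : FI (HomRel (FreeMonoid A)) ≃* FreeInverseMonoid A,
      (∀ x, β x⁻¹ = (β x)⁻¹) ∧
      ∀ a : A, β (FI.gen _ (FreeMonoid.of a)) = FreeInverseMonoid.of a := by
  let f := FreeRestrictionMonoid.lift
    (FreeMonoid.lift (FreeInverseMonoid.of : A → FreeInverseMonoid A))
  have hf (x y) (h : HomRel (FreeMonoid A) x y) : f x = f y := by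
    obtain _ | ⟨m, n⟩ := h
    · exact map_one (FreeMonoid.lift FreeInverseMonoid.of)
    · exact (map_mul (FreeMonoid.lift FreeInverseMonoid.of) m n).symm
  let α := FI.lift f hf
  have hα (v) : α (FI.gen _ v) = FreeMonoid.lift FreeInverseMonoid.of v := rfl
  have hαi : ∀ x, α x⁻¹ = (α x)⁻¹ := FI.lift_inv f hf
  let β : FreeInverseMonoid A →* FI (HomRel (FreeMonoid A)) :=
    FreeInverseMonoid.lift fun a => FI.gen _ (FreeMonoid.of a)
  have hβ (a) : β (.of a) = FI.gen _ (FreeMonoid.of a) := rfl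
  have hβi : ∀ x, β x⁻¹ = (β x)⁻¹ := FreeInverseMonoid.lift_inv _
  refine ⟨{ α with invFun := β, left_inv := fun s => ?_, right_inv := fun s => ?_ }, hαi,
    fun a => ?_⟩
  · change β (α s) = s
    refine FI.induction (P := fun s => β (α s) = s) ?_ (fun x y hx hy => ?_) (fun x hx => ?_)
      (fun v => ?_) s
    · rw [map_one, map_one]
    · rw [map_mul, map_mul, hx, hy]
    · rw [hαi, hβi, hx]
    -- That [v] is the product of its letters is inherited from ⌊v⌋ along `FR.toFI`.
    · rw [hα, map_freeMonoid_lift, ← FR.toFI_gen, ← FR.freeMonoid_lift_gen, map_freeMonoid_lift]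
      rfl
  · change α (β s) = s
    refine FreeInverseMonoid.hom_ext (f := α.comp β) (g := MonoidHom.id _) (fun x => ?_)
      (fun _ => rfl) (fun a => ?_) s
    · change α (β _) = (α (β _))⁻¹
      rw [hβi, hαi]
    · change α (β (.of a)) = .of a
      rw [hβ, hα, FreeMonoid.lift_eval_of]
  · change α (FI.gen _ (FreeMonoid.of a)) = .of a
    rw [hα, FreeMonoid.lift_eval_of]

/-- A word in positive letters has nothing to cancel, so it is its own reduced form and can be read
off from its value in the free group. -/
theorem freeMonoid_lift_freeGroup_of_injective (A : Type w) :
    Function.Injective (FreeMonoid.lift (FreeGroup.of : A → FreeGroup A)) := by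
  classical
  have key (v : FreeMonoid A) : (FreeMonoid.lift (FreeGroup.of : A → FreeGroup A) v).toWord =
      v.toList.map fun a => (a, true) := by
    induction v using FreeMonoid.inductionOn' with
    | one => rfl
    | of_mul a v ih =>
      rw [map_mul, FreeMonoid.lift_eval_of, FreeGroup.toWord_mul, ih, FreeGroup.toWord_of,
        FreeMonoid.toList_of_mul, List.singleton_append, List.map_cons, FreeGroup.reduce.cons,
        ← ih, FreeGroup.reduce_toWord, ih]
      cases v.toList <;> simp
  intro v w h
  have := (key v).symm.trans ((congrArg FreeGroup.toWord h).trans (key w))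
  exact FreeMonoid.toList.injective
    (List.map_injective_iff.2 (fun a b h => congrArg Prod.fst h) this)

theorem exists_freeRestrictionMonoid_iso (A : Type w) :
    ∃ T : RestrictionSubmonoid (FreeInverseMonoid A),
      (T : Set (FreeInverseMonoid A)) =
        {x | ∃ (e : FreeInverseMonoid A) (v : FreeMonoid A),
          IsIdempotentElem e ∧ x = e * FreeMonoid.lift FreeInverseMonoid.of v} ∧
      (∃ γ : RestrictionMonoidHom (FreeRestrictionMonoid A) T, Function.Bijective γ ∧
        ∀ a : A, (γ (FreeRestrictionMonoid.of a) : FreeInverseMonoid A) =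
          FreeInverseMonoid.of a) ∧
      T = RestrictionSubmonoid.closure (Set.range FreeInverseMonoid.of) ∧
      T.toSubmonoid = Submonoid.closure
        ({e | IsIdempotentElem e} ∪ Set.range FreeInverseMonoid.of) := by
  let := Group.toInverseMonoid (FreeGroup A)
  let μ := RestrictionMonoid.munnHom (FreeRestrictionMonoid A)
  exact RestrictionMonoidHom.exists_range_eq (θ := FreeMonoid.lift FreeRestrictionMonoid.of)
    (g := FreeRestrictionMonoid.of) (φ := toFreeInverse A)
    -- Evaluation of words is multiplicative, so the correcting projection is 1.
    (map_one _) (fun m n => ⟨1, RestrictionMonoid.rplus_one, by rw [one_mul, map_mul]⟩)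
    (fun a => ⟨FreeMonoid.of a, (FreeMonoid.lift_eval_of _ a).symm⟩)
    (fun v => by
      induction v using FreeMonoid.inductionOn' with
      | one => rw [map_one]; exact one_mem _
      | of_mul a v ih =>
        rw [map_mul, FreeMonoid.lift_eval_of]
        exact mul_mem (Submonoid.subset_closure ⟨a, rfl⟩) ih)
    FreeRestrictionMonoid.mem_of_forall_of_mem
    (fun _ h₁ h₂ h₃ h₄ => FreeInverseMonoid.induction h₄ h₁ h₂ h₃)
    (lift_toFreeInverse μ)
    (κ := FreeInverseMonoid.lift FreeGroup.of) (freeMonoid_lift_freeGroup_of_injective A)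
    (fun v => by rw [map_freeMonoid_lift, map_freeMonoid_lift]; rfl)
    (fun _ => rfl) (fun v => by rw [map_freeMonoid_lift]; rfl)

end MonoidExpansion

theorem mainTheorem5 :
    (∀ (M : Type u) [Monoid M] (G : Type v) [Group G] (j : M →* G), Function.Injective j →
      ∀ R : FreeRestrictionMonoid M → FreeRestrictionMonoid M → Prop,
        MonoidExpansion.Admissible R →
        ∃ T : RestrictionSubmonoid (MonoidExpansion.FI R),
          (T : Set (MonoidExpansion.FI R)) =
            {x | ∃ (e : MonoidExpansion.FI R) (m : M),
              IsIdempotentElem e ∧ x = e * MonoidExpansion.FI.gen R m} ∧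
          (∃ φ : RestrictionMonoidHom (MonoidExpansion.FR R) T, Function.Bijective φ ∧
            ∀ m : M, (φ (MonoidExpansion.FR.gen R m) : MonoidExpansion.FI R) =
              MonoidExpansion.FI.gen R m) ∧
          T = RestrictionSubmonoid.closure (Set.range (MonoidExpansion.FI.gen R)) ∧
          T.toSubmonoid = Submonoid.closure
            ({e | IsIdempotentElem e} ∪ Set.range (MonoidExpansion.FI.gen R))) ∧
    (∀ A : Type w,
      MonoidExpansion.Admissible (MonoidExpansion.HomRel (FreeMonoid A)) ∧
      (∃ α : RestrictionMonoidHom (MonoidExpansion.FR (MonoidExpansion.HomRel (FreeMonoid A)))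
          (FreeRestrictionMonoid A), Function.Bijective α ∧
        ∀ a : A, α (MonoidExpansion.FR.gen _ (FreeMonoid.of a)) = FreeRestrictionMonoid.of a) ∧
      (∃ β : MonoidExpansion.FI (MonoidExpansion.HomRel (FreeMonoid A)) ≃* FreeInverseMonoid A,
        (∀ x, β x⁻¹ = (β x)⁻¹) ∧
        ∀ a : A, β (MonoidExpansion.FI.gen _ (FreeMonoid.of a)) = FreeInverseMonoid.of a) ∧
      ∃ T : RestrictionSubmonoid (FreeInverseMonoid A),
        (T : Set (FreeInverseMonoid A)) =
          {x | ∃ (e : FreeInverseMonoid A) (v : FreeMonoid A),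
            IsIdempotentElem e ∧ x = e * FreeMonoid.lift FreeInverseMonoid.of v} ∧
        (∃ γ : RestrictionMonoidHom (FreeRestrictionMonoid A) T, Function.Bijective γ ∧
          ∀ a : A, (γ (FreeRestrictionMonoid.of a) : FreeInverseMonoid A) =
            FreeInverseMonoid.of a) ∧
        T = RestrictionSubmonoid.closure (Set.range FreeInverseMonoid.of) ∧
        T.toSubmonoid = Submonoid.closure
          ({e | IsIdempotentElem e} ∪ Set.range FreeInverseMonoid.of)) := by
  exact ⟨fun _ _ _ _ j hj _ hR => MonoidExpansion.exists_FR_iso_FI j hj hR, fun A =>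
    ⟨MonoidExpansion.admissible_homRel _, MonoidExpansion.exists_FR_iso_freeRestrictionMonoid A,
      MonoidExpansion.exists_FI_mulEquiv_freeInverseMonoid A,
      MonoidExpansion.exists_freeRestrictionMonoid_iso A⟩⟩
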